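/- Let $X, Y$ be positive definite complex $n\times n$ matrices and let $z\in\mathbb{C}$ satisfy $\operatorname{Re} z\in[\tfrac14,\tfrac34]$. Then $$\left|\operatorname{Tr}\left(X^{1/2}\,Y^{z}\,X^{1/2}\,Y^{1-z}\right)\right|\le \operatorname{Tr}(XY),$$ where $X^{1/2}$ is the positive square root of $X$ and $Y^{w}=\exp(w\log Y)$ for $w\in\mathbb{C}$, with $\log Y$ defined by the functional calculus. -/

import Mathlib

open scoped ComplexOrder MatrixOrder

/-- The complex power `A ^ z = exp (z log A)` of a positive definite complex matrix `A`. Here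
`log A` is given by the functional calculus of the self-adjoint matrix `A`, and `exp` is the
exponential power series. -/
noncomputable def matrixCPow {n : ℕ} (A : Matrix (Fin n) (Fin n) ℂ) (z : ℂ) :
    Matrix (Fin n) (Fin n) ℂ :=
  NormedSpace.exp (z • cfc Real.log A)

/-! Let `B` be the matrix of `X^{1/2}` in an orthonormal eigenbasis of `Y`, with eigenvalues `l`.
The left trace is `∑ |B i j|² l_j^z l_i^(1-z)`. Each term's modulus depends only on `Re z`, and
weighted AM-GM bounds it by `|B i j|² (Re z · l_j + (1 - Re z) l_i)`. As `|B i j|²` is symmetric,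
the bounds sum to `∑ |B i j|² l_i = Tr(XY)`. -/

open Matrix in
/-- The complex power of a positive definite matrix, in an orthonormal eigenbasis. -/
lemma matrixCPow_eq_conj_diagonal {n : ℕ} {Y : Matrix (Fin n) (Fin n) ℂ} (hY : Y.PosDef) (z : ℂ) :
    matrixCPow Y z = (hY.1.eigenvectorUnitary : Matrix (Fin n) (Fin n) ℂ) *
      diagonal (fun i => (hY.1.eigenvalues i : ℂ) ^ z) *
      star (hY.1.eigenvectorUnitary : Matrix (Fin n) (Fin n) ℂ) := by
  have hinv : (hY.1.eigenvectorUnitary : Matrix (Fin n) (Fin n) ℂ)⁻¹ =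
      star (hY.1.eigenvectorUnitary : Matrix (Fin n) (Fin n) ℂ) :=
    Matrix.inv_eq_right_inv (Unitary.coe_mul_star_self _)
  have hunit : IsUnit (hY.1.eigenvectorUnitary : Matrix (Fin n) (Fin n) ℂ) :=
    (Unitary.toUnits hY.1.eigenvectorUnitary).isUnit
  rw [matrixCPow, hY.1.cfc_eq, IsHermitian.cfc, Unitary.conjStarAlgAut_apply, ← hinv,
    ← smul_mul_assoc, ← mul_smul_comm, exp_conj _ _ hunit, ← diagonal_smul, exp_diagonal]
  congr 3
  funext i
  rw [Pi.coe_exp, ← Complex.exp_eq_exp_ℂ,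
    Complex.cpow_def_of_ne_zero (Complex.ofReal_ne_zero.2 (hY.eigenvalues_pos i).ne'),
    ← Complex.ofReal_log (hY.eigenvalues_pos i).le, mul_comm]
  rfl

open Matrix in
/-- The trace of `B D B E` for a Hermitian `B` and diagonal `D`, `E`. -/
lemma trace_hermitian_mul_diagonal {n : ℕ} {B : Matrix (Fin n) (Fin n) ℂ} (hB : B.IsHermitian)
    (d e : Fin n → ℂ) :
    (B * diagonal d * B * diagonal e).trace = ∑ i, ∑ j, ((‖B i j‖ ^ 2 : ℝ) : ℂ) * (d j * e i) := by
  simp only [trace, diag_apply, mul_diagonal]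
  simp only [mul_apply (M := B * diagonal d), mul_diagonal, Finset.sum_mul]
  refine Finset.sum_congr rfl fun i _ => Finset.sum_congr rfl fun j _ => ?_
  have h : B i j * B j i = ((‖B i j‖ ^ 2 : ℝ) : ℂ) := by
    rw [← hB.apply j i, RCLike.star_def, Complex.mul_conj']
    push_cast
    rfl
  rw [← h]
  ring

/-- The weighted arithmetic-geometric mean inequality, summed against symmetric weights. -/
lemma norm_sum_cpow_le {n : ℕ} {w : Fin n → Fin n → ℝ} (hw : ∀ i j, 0 ≤ w i j)
    (hsymm : ∀ i j, w i j = w j i) {l : Fin n → ℝ} (hl : ∀ i, 0 < l i) {z : ℂ}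
    (hz : z.re ∈ Set.Icc (0 : ℝ) 1) :
    ‖∑ i, ∑ j, (w i j : ℂ) * ((l j : ℂ) ^ z * (l i : ℂ) ^ (1 - z))‖ ≤
      ∑ i, ∑ j, w i j * l i := by
  calc _ ≤ ∑ i, ∑ j, w i j * (z.re * l j + (1 - z.re) * l i) := by
        refine norm_sum_le_of_le _ fun i _ => norm_sum_le_of_le _ fun j _ => ?_
        rw [norm_mul, norm_mul, Complex.norm_cpow_eq_rpow_re_of_pos (hl j),
          Complex.norm_cpow_eq_rpow_re_of_pos (hl i), Complex.norm_of_nonneg (hw i j),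
          Complex.sub_re, Complex.one_re]
        exact mul_le_mul_of_nonneg_left
          (Real.geom_mean_le_arith_mean2_weighted hz.1 (sub_nonneg.2 hz.2) (hl j).le (hl i).le
            (by ring)) (hw i j)
    _ = z.re * ∑ i, ∑ j, w i j * l j + (1 - z.re) * ∑ i, ∑ j, w i j * l i := by
        simp only [Finset.mul_sum, ← Finset.sum_add_distrib]
        exact Finset.sum_congr rfl fun i _ => Finset.sum_congr rfl fun j _ => by ring
    _ = ∑ i, ∑ j, w i j * l i := by
        have h : ∑ i, ∑ j, w i j * l j = ∑ i, ∑ j, w i j * l i := by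
          rw [Finset.sum_comm]
          exact Finset.sum_congr rfl fun i _ => Finset.sum_congr rfl fun j _ => by rw [hsymm]
        rw [h]
        ring

/-- The inequality is between complex numbers: it says that the trace of `X * Y` is real and that
it bounds the modulus on the left. -/
theorem theorem2p2 (n : ℕ) (X Y : Matrix (Fin n) (Fin n) ℂ) (hX : X.PosDef) (hY : Y.PosDef)
    (z : ℂ) (hz : z.re ∈ Set.Icc (1 / 4 : ℝ) (3 / 4)) :
    ((‖(CFC.sqrt X * matrixCPow Y z * CFC.sqrt X * matrixCPow Y (1 - z)).trace‖ : ℝ) : ℂ) ≤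
      (X * Y).trace := by
  set A := CFC.sqrt X
  have hAA : A * A = X := CFC.sqrt_mul_sqrt_self X hX.posSemidef.nonneg
  have hAh : A.IsHermitian := (Matrix.nonneg_iff_posSemidef.1 (CFC.sqrt_nonneg X)).1
  set U : Matrix (Fin n) (Fin n) ℂ := (hY.1.eigenvectorUnitary : Matrix (Fin n) (Fin n) ℂ)
  have hUU : U * star U = 1 := Unitary.coe_mul_star_self _
  set l := hY.1.eigenvalues 
  set B := star U * A * U with hB
  have hBh : B.IsHermitian := Matrix.isHermitian_conjTranspose_mul_mul U hAh
  have hconj (d e : Fin n → ℂ) :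
      (A * (U * Matrix.diagonal d * star U) * A * (U * Matrix.diagonal e * star U)).trace =
        (B * Matrix.diagonal d * B * Matrix.diagonal e).trace := by
    -- Cyclicity brings the last `star U` to the front, completing the first `B`.
    rw [← mul_assoc _ _ (star U), Matrix.trace_mul_comm]
    simp only [hB, mul_assoc]
  have hleft : (A * matrixCPow Y z * A * matrixCPow Y (1 - z)).trace =
      ∑ i, ∑ j, ((‖B i j‖ ^ 2 : ℝ) : ℂ) * ((l j : ℂ) ^ z * (l i : ℂ) ^ (1 - z)) := by
    rw [matrixCPow_eq_conj_diagonal hY, matrixCPow_eq_conj_diagonal hY, hconj,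
      trace_hermitian_mul_diagonal hBh]
  have hspec : Y = U * Matrix.diagonal (fun i => (l i : ℂ)) * star U :=
    hY.1.spectral_theorem
  have hright : (X * Y).trace = ((∑ i, ∑ j, ‖B i j‖ ^ 2 * l i : ℝ) : ℂ) := by
    -- The exponent `z = 0` of the same formula: the first power of `Y` becomes `1`, leaving `A * A
    -- * Y`.
    have h := hconj (fun _ => 1) (fun i => (l i : ℂ))
    rw [← hspec, Matrix.diagonal_one, mul_one, hUU, mul_one, hAA, ← Matrix.diagonal_one,
      trace_hermitian_mul_diagonal hBh] at h
    rw [h]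
    push_cast
    simp only [one_mul]
  rw [hleft, hright, Complex.real_le_real]
  refine norm_sum_cpow_le (fun i j => sq_nonneg _) (fun i j => ?_) hY.eigenvalues_pos
    ⟨by linarith [hz.1], by linarith [hz.2]⟩
  rw [← hBh.apply i j, norm_star]
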